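/- Let $R$ be a commutative Noetherian ring of prime characteristic $p>0$, and let $\mathfrak{a}\subseteq R$ be a perfect ideal, i.e. an ideal such that $\operatorname{grade}(\mathfrak{a})$, the maximal length of an $R$-regular sequence contained in $\mathfrak{a}$, is equal to the projective dimension of the $R$-module $R/\mathfrak{a}$ (in particular $\mathfrak{a}\neq R$, the zero module having projective dimension $-\infty$). Let $\operatorname{cd}(R,\mathfrak{a})$ denote the cohomological dimension of $\mathfrak{a}$, i.e. the least natural number $c$ such that the local cohomology modules $H^i_{\mathfrak{a}}(M)$ vanish for all $R$-modules $M$ and all $i>c$. Then $$\operatorname{cd}(R,\mathfrak{a})=\operatorname{ht}(\mathfrak{a}).$$ -/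

import Mathlib

universe u

/-- The grade of an ideal: the supremum of the lengths of the `R`-regular sequences
contained in it. -/
noncomputable def Ideal.grade {R : Type u} [CommRing R] (a : Ideal R) : ℕ∞ :=
  ⨆ (rs : List R) (_ : RingTheory.Sequence.IsRegular R rs ∧ ∀ r ∈ rs, r ∈ a),
    (rs.length : ℕ∞)

/-- An ideal `a` is perfect if its grade equals the projective dimension of `R ⧸ a`.
The zero module has projective dimension `⊥`, so a perfect ideal is proper. -/
def Ideal.IsPerfect {R : Type u} [CommRing R] (a : Ideal R) : Prop :=
  CategoryTheory.projectiveDimension (ModuleCat.of R (R ⧸ a)) = ((a.grade : ℕ∞) : WithBot ℕ∞)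

/-- The cohomological dimension of `a`: the least natural number `c` such that the local cohomology
modules `H^i_a(M)` vanish for all `R`-modules `M` and all `i > c` (and `⊤` if there is no
such `c`). -/
noncomputable def Ideal.cohomologicalDimension {R : Type u} [CommRing R] (a : Ideal R) : ℕ∞ :=
  ⨅ (c : ℕ) (_ : ∀ (M : ModuleCat.{u} R) (i : ℕ), c < i →
    CategoryTheory.Limits.IsZero ((localCohomology a i).obj M)), (c : ℕ∞)

-- Let g be the common value of the grade and the projective dimension of R/a, realised by a regular
-- sequence inside `a`. Both the cohomological dimension and the height equal g.
--
-- Vanishing above g: write a resolution of R/a by finite free modules as matrices and raise all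
-- entries to the p^e-th power. On the resolution, elements of `a` are null-homotopic, and above
-- degree g the identity is. These are matrix identities, so they survive Frobenius; powers of a
-- regular sequence stay weakly regular. The acyclicity lemma `Matrix.exact_of_isWeaklyRegular` then
-- shows that the twisted complex resolves R/a^[p^e], whose projective dimension is therefore at
-- most g. Frobenius powers are cofinal among the powers of `a`, so the colimit of Ext^i(R/a^n, M)
-- is zero for i > g.
--
-- Nonvanishing in degree g > 0: Ext^g(R/a, F) is nonzero for some free F. The kernel of R/a^k → R/a
-- is killed by the k-th powers of the regular sequence, so its Ext^(g-1) into F vanishes and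
-- Ext^g(R/a, F) → Ext^g(R/a^k, F) is injective. Hence a nonzero class survives in the colimit.
--
-- Height: a regular sequence of length g gives one inequality. For the other, localise at a minimal
-- prime of `a` to get A. The degree-0 homology of the e-th Frobenius twist has length at most
-- c·p^(eg) (`Matrix.exists_length_homology_le`), yet it surjects onto A/m^(p^e). Such growth forces
-- dim A ≤ g (`ringKrullDim_le_of_length_le`).

universe v w

/-! ### Complexes of matrices and null-homotopies. -/

section

open Module

namespace Matrix

variable {R : Type u} [CommRing R] {l m n k : ℕ}

section act

variable (N : Type v) [AddCommGroup N] [Module R N]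

/-- The linear map `Nⁿ → Nᵐ` given by an `m × n` matrix with entries in the base ring. -/
def act (A : Matrix (Fin m) (Fin n) R) : (Fin n → N) →ₗ[R] (Fin m → N) where
  toFun v i := ∑ j, A i j • v j
  map_add' v w := by ext i; simp [smul_add, Finset.sum_add_distrib]
  map_smul' c v := by ext i; simp [Finset.smul_sum, smul_comm c]

variable {N}

lemma act_apply (A : Matrix (Fin m) (Fin n) R) (v : Fin n → N) (i : Fin m) :
    A.act N v i = ∑ j, A i j • v j := rfl

lemma act_mul (A : Matrix (Fin m) (Fin n) R) (B : Matrix (Fin n) (Fin k) R) (v : Fin k → N) :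
    (A * B).act N v = A.act N (B.act N v) := by
  ext i
  simp only [act_apply, mul_apply, Finset.sum_smul, Finset.smul_sum, mul_smul]
  exact Finset.sum_comm

lemma act_add (A B : Matrix (Fin m) (Fin n) R) (v : Fin n → N) :
    (A + B).act N v = A.act N v + B.act N v := by
  ext i; simp [act_apply, add_smul, Finset.sum_add_distrib]

lemma act_zero (v : Fin n → N) : (0 : Matrix (Fin m) (Fin n) R).act N v = 0 := by
  ext i; simp [act_apply]

lemma act_smul_one (x : R) (v : Fin n → N) :
    (x • (1 : Matrix (Fin n) (Fin n) R)).act N v = x • v := by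
  ext i; simp [act_apply, one_apply]

lemma act_eq_mulVec (A : Matrix (Fin m) (Fin n) R) (v : Fin n → R) : A.act R v = A *ᵥ v := by
  ext i; simp [act_apply, mulVec, dotProduct]

lemma act_comp {N' : Type w} [AddCommGroup N'] [Module R N'] (f : N →ₗ[R] N')
    (A : Matrix (Fin m) (Fin n) R) (v : Fin n → N) :
    A.act N' (f ∘ v) = f ∘ A.act N v := by
  ext i; simp [act_apply]

/-- A matrix whose columns lie in the range of `B` is a multiple of `B`. -/
lemma exists_mul_eq_of_forall_mem_range (B : Matrix (Fin m) (Fin n) R)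
    (C : Matrix (Fin m) (Fin k) R)
    (h : ∀ j, (fun i ↦ C i j) ∈ LinearMap.range (B.act R)) :
    ∃ X : Matrix (Fin n) (Fin k) R, B * X = C := by
  choose X hX using h
  refine ⟨.of fun i j ↦ X j i, ?_⟩
  ext i j
  simpa [act_apply, mul_apply] using congrFun (hX j) i

/-- Lifting along an exact pair of matrices. -/
lemma exists_mul_eq_of_exact {A : Matrix (Fin l) (Fin m) R} {B : Matrix (Fin m) (Fin n) R}
    (h : Function.Exact (B.act R) (A.act R)) (C : Matrix (Fin m) (Fin k) R) (hC : A * C = 0) :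
    ∃ X : Matrix (Fin n) (Fin k) R, B * X = C := by
  refine exists_mul_eq_of_forall_mem_range B C fun j ↦ ?_
  refine (h _).mp ?_
  ext i
  simpa [act_apply, mul_apply] using congrFun (congrFun hC i) j

end act

/-- Multiplication by `x` on the middle term of the complex given by the matrices `A` and `B`
is null-homotopic. -/
def NullAt (A : Matrix (Fin l) (Fin m) R) (B : Matrix (Fin m) (Fin n) R) (x : R) : Prop :=
  ∃ (s : Matrix (Fin m) (Fin l) R) (t : Matrix (Fin n) (Fin m) R),
    B * t + s * A = x • (1 : Matrix (Fin m) (Fin m) R)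

namespace NullAt

variable {A : Matrix (Fin l) (Fin m) R} {B : Matrix (Fin m) (Fin n) R} {x : R}

lemma map {S : Type v} [CommRing S] (φ : R →+* S) (h : NullAt A B x) :
    NullAt (A.map φ) (B.map φ) (φ x) := by
  obtain ⟨s, t, h⟩ := h
  refine ⟨s.map φ, t.map φ, ?_⟩
  rw [← Matrix.map_mul, ← Matrix.map_mul, ← Matrix.map_add _ (map_add φ), h]
  ext i j
  simp [one_apply, apply_ite φ]

/-- If `x` is null-homotopic then it kills the homology. -/
lemma smul_mem_range (h : NullAt A B x) {N : Type v} [AddCommGroup N] [Module R N]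
    {z : Fin m → N} (hz : A.act N z = 0) : ∃ w, B.act N w = x • z := by
  obtain ⟨s, t, h⟩ := h
  refine ⟨t.act N z, ?_⟩
  have := congrArg (fun X ↦ act N X z) h
  simpa [act_add, act_mul, hz, act_smul_one] using this

/-- A null-homotopy extends one step along an exact complex. -/
lemma succ {C : Matrix (Fin n) (Fin k) R} (h : NullAt A B x) (hAB : A * B = 0)
    (hBC : Function.Exact (C.act R) (B.act R)) : NullAt B C x := by
  obtain ⟨s, t, h⟩ := h
  -- The defect x - tB is killed by B: from Bt = x - sA one gets B(x - tB) = sAB = 0.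
  obtain ⟨X, hX⟩ := exists_mul_eq_of_exact hBC (x • 1 - t * B) (by
    have : B * t = x • 1 - s * A := eq_sub_of_add_eq h
    rw [Matrix.mul_sub, ← Matrix.mul_assoc, this, Matrix.sub_mul, Matrix.mul_assoc, hAB]
    simp)
  exact ⟨t, X, by rw [hX]; abel⟩

end NullAt

section shift

variable {A : Matrix (Fin l) (Fin m) R} {B : Matrix (Fin m) (Fin n) R}
  {C : Matrix (Fin n) (Fin k) R} {N : Type v} [AddCommGroup N] [Module R N]

open scoped Pointwise

lemma exists_comp_mkQ (P : Submodule R N) (v : Fin n → N ⧸ P) : ∃ w : Fin n → N, v = P.mkQ ∘ w := by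
  choose w hw using fun i ↦ P.mkQ_surjective (v i)
  exact ⟨w, funext fun i ↦ (hw i).symm⟩

lemma exists_eq_smul_of_mkQ_comp_eq_zero (y : R) (v : Fin n → N)
    (h : (y • (⊤ : Submodule R N)).mkQ ∘ v = 0) : ∃ u : Fin n → N, v = y • u := by
  have (i : Fin n) : ∃ u : N, y • u = v i := by
    have := congrFun h i
    simp only [Function.comp_apply, Submodule.mkQ_apply, Pi.zero_apply,
      Submodule.Quotient.mk_eq_zero] at this
    obtain ⟨u, -, hu⟩ := (Submodule.mem_smul_pointwise_iff_exists _ _ _).mp this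
    exact ⟨u, hu⟩
  choose u hu using this
  exact ⟨u, funext fun i ↦ (hu i).symm⟩

lemma mkQ_comp_smul (y : R) (v : Fin n → N) :
    (y • (⊤ : Submodule R N)).mkQ ∘ (y • v) = 0 := by
  ext i
  simp only [Function.comp_apply, Submodule.mkQ_apply, Pi.zero_apply, Pi.smul_apply,
      Submodule.Quotient.mk_eq_zero]
  exact Submodule.smul_mem_pointwise_smul _ _ _ trivial

lemma smul_fun_injective {y : R} (hy : IsSMulRegular N y) {v w : Fin n → N} (h : y • v = y • w) :
    v = w :=
  funext fun i ↦ hy (congrFun h i)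

/-- The connecting map argument: a boundary modulo `y` is divided by `y`. -/
lemma eq_of_connecting {y : R} (hy : IsSMulRegular N y) (hBC : B * C = 0) {z : Fin m → N}
    {w : Fin n → N} (hw : B.act N w = y • z)
    {v : Fin k → QuotSMulTop y N}
    (hv : C.act _ v = (y • (⊤ : Submodule R N)).mkQ ∘ w) : ∃ u, B.act N u = z := by
  obtain ⟨v, rfl⟩ := exists_comp_mkQ _ v
  rw [act_comp] at hv
  obtain ⟨u, hu⟩ := exists_eq_smul_of_mkQ_comp_eq_zero y (w - C.act N v) (by
    ext i
    simpa [sub_eq_zero] using (congrFun hv i).symm)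
  refine ⟨u, smul_fun_injective hy ?_⟩
  rw [← hw, ← map_smul, ← hu, map_sub, ← act_mul, hBC, act_zero, sub_zero]

/-- The long exact sequence of 0 → N → N → N/yN → 0 (multiplication by y): as y kills the homology
with coefficients N, the connecting map from one degree higher over N/yN is onto it. -/
lemma exact_of_exact_quotSMulTop {y : R} (hy : IsSMulRegular N y) (hAB : A * B = 0)
    (hBC : B * C = 0) (hn : NullAt A B y)
    (h : Function.Exact (C.act (QuotSMulTop y N)) (B.act (QuotSMulTop y N))) :
    Function.Exact (B.act N) (A.act N) := by
  intro z
  refine ⟨fun hz ↦ ?_, ?_⟩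
  · obtain ⟨w, hw⟩ := hn.smul_mem_range hz
    obtain ⟨v, hv⟩ := (h ((y • (⊤ : Submodule R N)).mkQ ∘ w)).mp (by
      erw [act_comp, hw, mkQ_comp_smul])
    exact eq_of_connecting hy hBC hw hv
  · rintro ⟨w, rfl⟩
    rw [← act_mul, hAB, act_zero]

end shift

end Matrix

end

/-! ### Weakly regular sequences and the acyclicity lemma. -/

section

open Module

namespace QuotSMulTop

open scoped Pointwise

variable {R : Type u} [CommRing R]

lemma mk_eq_zero_iff {M : Type v} [AddCommGroup M] [Module R M] {r : R} {x : M} :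
    (Submodule.Quotient.mk x : QuotSMulTop r M) = 0 ↔ ∃ y, r • y = x := by
  rw [Submodule.Quotient.mk_eq_zero, Submodule.mem_smul_pointwise_iff_exists]
  simp

/-- The obstruction is the r-torsion of M'': if f x = r y, then g y is r-torsion, so y comes from M.
-/
lemma map_injective_of_isSMulRegular {M M' M'' : Type*} [AddCommGroup M] [Module R M]
    [AddCommGroup M'] [Module R M'] [AddCommGroup M''] [Module R M''] {r : R}
    {f : M →ₗ[R] M'} {g : M' →ₗ[R] M''} (hf : Function.Injective f) (hfg : Function.Exact f g)
    (hr : IsSMulRegular M'' r) : Function.Injective (QuotSMulTop.map r f) := by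
  rw [injective_iff_map_eq_zero]
  intro x hx
  obtain ⟨x, rfl⟩ := Submodule.Quotient.mk_surjective _ x
  rw [map_apply_mk, mk_eq_zero_iff] at hx
  obtain ⟨y, hy⟩ := hx
  have hgy : g y = 0 := by
    apply hr.right_eq_zero_of_smul
    rw [← map_smul, hy, hfg.apply_apply_eq_zero]
  obtain ⟨z, rfl⟩ := (hfg y).mp hgy
  exact mk_eq_zero_iff.mpr ⟨z, hf (by rw [map_smul, hy])⟩

/-- For a regular element `x`, the quotient `N / xⁿ⁺¹N` is an extension of `N / xN` by
`N / xⁿN`. -/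
lemma exists_exact_pow_succ {N : Type v} [AddCommGroup N] [Module R N] {x : R}
    (hx : IsSMulRegular N x) (n : ℕ) :
    ∃ (f : QuotSMulTop (x ^ n) N →ₗ[R] QuotSMulTop (x ^ (n + 1)) N)
      (g : QuotSMulTop (x ^ (n + 1)) N →ₗ[R] QuotSMulTop x N),
      Function.Injective f ∧ Function.Surjective g ∧ Function.Exact f g := by
  have mem (a : R) (b : N) : a • b ∈ a • (⊤ : Submodule R N) :=
    Submodule.smul_mem_pointwise_smul _ _ _ trivial
  let f : QuotSMulTop (x ^ n) N →ₗ[R] QuotSMulTop (x ^ (n + 1)) N :=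
    Submodule.mapQ _ _ (LinearMap.lsmul R N x) (by
      intro y hy
      obtain ⟨z, -, rfl⟩ := (Submodule.mem_smul_pointwise_iff_exists _ _ _).mp hy
      change x • x ^ n • z ∈ x ^ (n + 1) • (⊤ : Submodule R N)
      rw [smul_smul, ← pow_succ']
      exact mem _ z)
  let g : QuotSMulTop (x ^ (n + 1)) N →ₗ[R] QuotSMulTop x N :=
    Submodule.mapQ _ _ LinearMap.id (by
      intro y hy
      obtain ⟨z, -, rfl⟩ := (Submodule.mem_smul_pointwise_iff_exists _ _ _).mp hy
      simpa [smul_smul, ← pow_succ'] using mem x (x ^ n • z))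
  have hf (y : N) : f (Submodule.Quotient.mk y) = Submodule.Quotient.mk (x • y) := rfl
  have hg (y : N) : g (Submodule.Quotient.mk y) = Submodule.Quotient.mk y := rfl
  refine ⟨f, g, ?_, ?_, ?_⟩
  · rw [injective_iff_map_eq_zero]
    intro y hy
    obtain ⟨y, rfl⟩ := Submodule.Quotient.mk_surjective _ y
    rw [hf, mk_eq_zero_iff] at hy
    obtain ⟨z, hz⟩ := hy
    exact mk_eq_zero_iff.mpr ⟨z, hx (by simpa [smul_smul, ← pow_succ'] using hz)⟩
  · intro y
    obtain ⟨y, rfl⟩ := Submodule.Quotient.mk_surjective _ y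
    exact ⟨Submodule.Quotient.mk y, hg y⟩
  · intro y
    obtain ⟨y, rfl⟩ := Submodule.Quotient.mk_surjective _ y
    rw [hg, mk_eq_zero_iff]
    constructor
    · rintro ⟨z, rfl⟩
      exact ⟨Submodule.Quotient.mk z, hf z⟩
    · rintro ⟨z, hz⟩
      obtain ⟨z, rfl⟩ := Submodule.Quotient.mk_surjective _ z
      rw [hf, ← sub_eq_zero, ← Submodule.Quotient.mk_sub, mk_eq_zero_iff] at hz
      obtain ⟨t, ht⟩ := hz
      refine ⟨z - x ^ n • t, ?_⟩
      rw [smul_sub, smul_smul, ← pow_succ', ht]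
      abel

end QuotSMulTop

namespace RingTheory.Sequence.IsWeaklyRegular

variable {R : Type u} [CommRing R]

lemma of_subsingleton (M : Type v) [AddCommGroup M] [Module R M] [Subsingleton M] (rs : List R) :
    IsWeaklyRegular M rs :=
  ⟨fun _ _ ↦ Function.injective_of_subsingleton _⟩

lemma of_exact {M M' M'' : Type v} [AddCommGroup M] [Module R M]
    [AddCommGroup M'] [Module R M'] [AddCommGroup M''] [Module R M''] {rs : List R}
    {f : M →ₗ[R] M'} {g : M' →ₗ[R] M''} (hf : Function.Injective f) (hg : Function.Surjective g)
    (hfg : Function.Exact f g) (h : IsWeaklyRegular M rs) (h'' : IsWeaklyRegular M'' rs) :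
    IsWeaklyRegular M' rs := by
  induction rs generalizing M M' M'' with
  | nil => simp
  | cons r rs ih =>
    rw [isWeaklyRegular_cons_iff] at h h'' ⊢
    exact ⟨isSMulRegular_of_range_eq_ker hf hfg.linearMap_ker_eq.symm h.1 h''.1,
      ih (QuotSMulTop.map_injective_of_isSMulRegular hf hfg h''.1)
        (QuotSMulTop.map_surjective r hg) (QuotSMulTop.map_exact r hfg hg) h.2 h''.2⟩

/-- Powers of the elements of a weakly regular sequence form a weakly regular sequence. -/
lemma map_pow {M : Type v} [AddCommGroup M] [Module R M] {rs : List R}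
    (h : IsWeaklyRegular M rs) (n : ℕ) : IsWeaklyRegular M (rs.map (· ^ n)) := by
  induction rs generalizing M with
  | nil => simp
  | cons r rs ih =>
    rw [isWeaklyRegular_cons_iff] at h
    rw [List.map_cons, isWeaklyRegular_cons_iff]
    -- It remains to treat the original tail on M/rⁿM, which is filtered by copies of M/rM; hence a
    -- second induction, on the exponent.
    refine ⟨h.1.pow n, ih ?_⟩
    clear ih
    induction n with
    | zero =>
      have : Subsingleton (QuotSMulTop (r ^ 0) M) := by
        rw [pow_zero, Submodule.Quotient.subsingleton_iff]
        simp
      exact of_subsingleton _ _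
    | succ n ihn =>
      obtain ⟨f, g, hf, hg, hfg⟩ := QuotSMulTop.exists_exact_pow_succ h.1 n
      exact of_exact hf hg hfg ihn h.2

end RingTheory.Sequence.IsWeaklyRegular

namespace Matrix

variable {R : Type u} [CommRing R] {r : ℕ → ℕ}
  {E : ∀ i, Matrix (Fin (r i)) (Fin (r (i + 1))) R}

/-- The acyclicity lemma: if the complex `E` is contractible above degree `g`, and a weakly regular
sequence on `N` consists of elements which are null-homotopic on `E`, then the homology of `E ⊗ N`
vanishes above degree `g` minus the length of the sequence. -/
lemma exact_of_isWeaklyRegular (hE : ∀ i, E i * E (i + 1) = 0) {g : ℕ}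
    (hg : ∀ i, g < i → NullAt (E i) (E (i + 1)) 1) {rs : List R}
    (hrs : ∀ y ∈ rs, ∀ i, NullAt (E i) (E (i + 1)) y)
    {N : Type v} [AddCommGroup N] [Module R N] (h : RingTheory.Sequence.IsWeaklyRegular N rs)
    {i : ℕ} (hi : g < i + rs.length) :
    Function.Exact ((E (i + 1)).act N) ((E i).act N) := by
  induction rs generalizing N i with
  | nil =>
    intro z
    refine ⟨fun hz ↦ ?_, ?_⟩
    · obtain ⟨w, hw⟩ := (hg i (by simpa using hi)).smul_mem_range hz
      exact ⟨w, by rw [hw, one_smul]⟩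
    · rintro ⟨w, rfl⟩
      rw [← act_mul, hE, act_zero]
  | cons y rs ih =>
    rw [RingTheory.Sequence.isWeaklyRegular_cons_iff] at h
    -- Passing to N/yN raises the degree by one and shortens the sequence by one, so the bound `hi`
    -- is preserved.
    refine exact_of_exact_quotSMulTop h.1 (hE i) (hE (i + 1)) (hrs y (by simp) i) ?_
    exact ih (fun z hz ↦ hrs z (by simp [hz])) h.2 (by simp at hi; omega)

end Matrix

end

/-! ### Projective dimension in terms of matrices, cyclic resolutions, base change along Frobenius.
-/

section

open Module CategoryTheory

namespace Matrix

variable {R : Type u} [CommRing R] {l m n k : ℕ}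

section coker

/-- The matrix `B` has an inner inverse, that is, its cokernel splits off. -/
def HasInnerInverse (B : Matrix (Fin m) (Fin n) R) : Prop :=
  ∃ S : Matrix (Fin n) (Fin m) R, B * S * B = B

/-- The cokernel of the map of free modules given by a matrix. -/
abbrev Coker (A : Matrix (Fin m) (Fin n) R) : Type u :=
  (Fin m → R) ⧸ LinearMap.range (A.act R)

/-- Dimension shifting: exactness identifies the cokernel of B with the image of A, the first syzygy
of the cokernel of A. -/
lemma hasProjectiveDimensionLT_coker_iff {A : Matrix (Fin l) (Fin m) R}
    {B : Matrix (Fin m) (Fin n) R} (h : Function.Exact (B.act R) (A.act R)) (d : ℕ) :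
    HasProjectiveDimensionLT (ModuleCat.of R A.Coker) (d + 2) ↔
      HasProjectiveDimensionLT (ModuleCat.of R B.Coker) (d + 1) := by
  have hker : LinearMap.ker (A.act R) = LinearMap.range (B.act R) := h.linearMap_ker_eq
  let f : B.Coker →ₗ[R] (Fin l → R) := (LinearMap.range (B.act R)).liftQ (A.act R) hker.ge
  have hf : Function.Injective f := by
    rw [← LinearMap.ker_eq_bot]
    exact Submodule.ker_liftQ_eq_bot _ _ _ hker.le
  have hfr : LinearMap.range f = LinearMap.range (A.act R) := Submodule.range_liftQ _ _ _
  let S : ShortComplex (ModuleCat.{u} R) :=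
    ShortComplex.mk (ModuleCat.ofHom f)
      (ModuleCat.ofHom (LinearMap.range (A.act R)).mkQ) (by
        rw [← ModuleCat.ofHom_comp, ← ModuleCat.ofHom_zero]
        congr 1
        rw [← LinearMap.range_le_ker_iff]
        simp [hfr])
  have hS : S.ShortExact := by
    refine @ShortComplex.ShortExact.mk _ _ _ S ?_
      ((ModuleCat.mono_iff_injective _).mpr hf)
      ((ModuleCat.epi_iff_surjective _).mpr (Submodule.mkQ_surjective _))
    rw [ShortComplex.ShortExact.moduleCat_exact_iff_function_exact, LinearMap.exact_iff]
    simp [S, hfr]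
  have hP : Projective S.X₂ := by
    change Projective (ModuleCat.of R (Fin l → R))
    rw [← IsProjective.iff_projective]
    infer_instance
  exact hS.hasProjectiveDimensionLT_X₃_iff d hP

/-- A section of the quotient map gives an idempotent X with XB = 0 and 1 - X = BS, whence BSB = B;
conversely 1 - BS descends to a section. Projectivity becomes an equation, which any ring
homomorphism preserves. -/
lemma projective_coker_iff (B : Matrix (Fin m) (Fin n) R) :
    Module.Projective R B.Coker ↔ B.HasInnerInverse := by
  constructor
  · intro h
    obtain ⟨σ, hσ⟩ := Module.projective_lifting_property (LinearMap.range (B.act R)).mkQ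
      LinearMap.id (Submodule.mkQ_surjective _)
    let X : Matrix (Fin m) (Fin m) R :=
      LinearMap.toMatrix' (σ ∘ₗ (LinearMap.range (B.act R)).mkQ)
    have hX (v : Fin m → R) : X.act R v = σ (Submodule.Quotient.mk v) := by
      rw [act_eq_mulVec, ← toLin'_apply, toLin'_toMatrix']
      rfl
    obtain ⟨S, hS⟩ := exists_mul_eq_of_forall_mem_range B (1 - X) (by
      intro j
      rw [← Submodule.Quotient.mk_eq_zero]
      have : (fun i ↦ (1 - X) i j) = Pi.single j 1 - X.act R (Pi.single j 1) := by
        ext i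
        simp [act_eq_mulVec, one_apply, Pi.single_apply]
      rw [this, Submodule.Quotient.mk_sub, hX, sub_eq_zero]
      exact (LinearMap.congr_fun hσ _).symm)
    refine ⟨S, ?_⟩
    rw [hS, Matrix.sub_mul, Matrix.one_mul, sub_eq_self]
    apply toLin'.injective
    ext1 j
    ext1
    simp only [LinearMap.comp_apply, toLin'_apply, ← act_eq_mulVec, map_zero,
      LinearMap.zero_apply]
    rw [act_mul, hX, (Submodule.Quotient.mk_eq_zero _).mpr (LinearMap.mem_range_self _ _),
      map_zero]
  · rintro ⟨S, hS⟩
    let f : (Fin m → R) →ₗ[R] (Fin m → R) := LinearMap.id - (B * S).act R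
    let σ : B.Coker →ₗ[R] (Fin m → R) := (LinearMap.range (B.act R)).liftQ f (by
      rintro _ ⟨v, rfl⟩
      simp only [LinearMap.mem_ker, f, LinearMap.sub_apply, LinearMap.id_apply]
      rw [← act_mul, hS, sub_self])
    refine Module.Projective.of_split σ (LinearMap.range (B.act R)).mkQ ?_
    refine Submodule.linearMap_qext _ (LinearMap.ext fun v ↦ ?_)
    change Submodule.Quotient.mk (v - (B * S).act R v) = Submodule.Quotient.mk v
    rw [Submodule.Quotient.eq, act_mul]
    exact ⟨-S.act R v, by rw [map_neg]; abel⟩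

variable {r : ℕ → ℕ} {E : ∀ i, Matrix (Fin (r i)) (Fin (r (i + 1))) R}

lemma hasProjectiveDimensionLT_coker_iff_exists
    (h : ∀ i, 1 ≤ i → Function.Exact ((E (i + 1)).act R) ((E i).act R)) (d : ℕ) :
    HasProjectiveDimensionLT (ModuleCat.of R (E 1).Coker) (d + 1) ↔
      (E (d + 1)).HasInnerInverse := by
  suffices ∀ d j i, 1 ≤ j → j + d = i →
      (HasProjectiveDimensionLT (ModuleCat.of R (E j).Coker) (d + 1) ↔
        (E i).HasInnerInverse) from this d 1 (d + 1) le_rfl (add_comm _ _)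
  intro d
  induction d with
  | zero =>
    rintro j _ hj rfl
    rw [zero_add, ← projective_iff_hasProjectiveDimensionLT_one, ← IsProjective.iff_projective]
    exact projective_coker_iff (E j)
  | succ d ih =>
    rintro j i hj hi
    rw [hasProjectiveDimensionLT_coker_iff (h j hj)]
    exact ih (j + 1) i (by omega) (by omega)

/-- An inner inverse S starts the contraction, since 1 - S E(d+1) is killed by E(d+1) and so factors
through the next matrix; `NullAt.succ` continues it. -/
lemma nullAt_one_of_split
    (h : ∀ i, 1 ≤ i → Function.Exact ((E (i + 1)).act R) ((E i).act R))
    (hE : ∀ i, E i * E (i + 1) = 0) {d : ℕ}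
    (hS : (E (d + 1)).HasInnerInverse) (i : ℕ) (hi : d < i) :
    NullAt (E i) (E (i + 1)) 1 := by
  induction i, hi using Nat.le_induction with
  | base =>
    obtain ⟨S, hS⟩ := hS
    obtain ⟨t, ht⟩ := exists_mul_eq_of_exact (h (d + 1) (by omega)) (1 - S * E (d + 1)) (by
      rw [Matrix.mul_sub, Matrix.mul_one, ← Matrix.mul_assoc, hS, sub_self])
    exact ⟨S, t, by rw [ht]; simp⟩
  | succ i hi ih => exact ih.succ (hE i) (h (i + 1) (by omega))

end coker

section resolution

lemma mem_range_act_iff (G : Matrix (Fin 1) (Fin n) R) (v : Fin 1 → R) :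
    v ∈ LinearMap.range (G.act R) ↔ v 0 ∈ Ideal.span (Set.range (G 0)) := by
  rw [Ideal.mem_span_range_iff_exists_fun]
  constructor
  · rintro ⟨w, rfl⟩
    exact ⟨w, by simp [act_apply, mul_comm]⟩
  · rintro ⟨w, hw⟩
    refine ⟨w, ?_⟩
    ext i
    rw [Subsingleton.elim i 0, ← hw]
    simp [act_apply, mul_comm]

/-- The cokernel of a row is the quotient by the ideal its entries generate. -/
noncomputable def cokerEquivQuotient (G : Matrix (Fin 1) (Fin n) R) :
    G.Coker ≃ₗ[R] R ⧸ Ideal.span (Set.range (G 0)) :=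
  Submodule.Quotient.equiv _ _ (LinearEquiv.funUnique (Fin 1) R R) (by
    ext x
    simp only [Submodule.mem_map]
    constructor
    · rintro ⟨v, hv, rfl⟩
      exact (mem_range_act_iff G v).mp hv
    · intro hx
      exact ⟨fun _ ↦ x, (mem_range_act_iff G _).mpr hx, rfl⟩)

/-- The ranks in a free resolution of a cyclic module, extended by zero to the left. -/
def shape (r : ℕ → ℕ) : ℕ → ℕ
  | 0 => 0
  | 1 => 1
  | i + 2 => r i

/-- A resolution of a cyclic module `R ⧸ a` by finite free modules, given by matrices. -/
structure IsCyclicResolution (a : Ideal R) {r : ℕ → ℕ}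
    (E : ∀ i, Matrix (Fin (shape r i)) (Fin (shape r (i + 1))) R) : Prop where
  mul_eq_zero (i : ℕ) : E i * E (i + 1) = 0
  exact (i : ℕ) (hi : 1 ≤ i) : Function.Exact ((E (i + 1)).act R) ((E i).act R)
  span_eq : Ideal.span (Set.range (E 1 (0 : Fin 1))) = a

lemma exists_exact_act [IsNoetherianRing R] (A : Matrix (Fin m) (Fin n) R) :
    ∃ (k : ℕ) (B : Matrix (Fin n) (Fin k) R), Function.Exact (B.act R) (A.act R) := by
  obtain ⟨k, s, hs⟩ := Submodule.fg_iff_exists_fin_generating_family.mp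
    (IsNoetherian.noetherian (LinearMap.ker (A.act R)))
  refine ⟨k, .of fun i j ↦ s j i, ?_⟩
  rw [LinearMap.exact_iff, ← hs]
  ext v
  rw [Submodule.mem_span_range_iff_exists_fun]
  refine exists_congr fun c ↦ ?_
  rw [funext_iff, funext_iff]
  simp [act_apply, mul_comm]

theorem exists_isCyclicResolution [IsNoetherianRing R] (a : Ideal R) :
    ∃ (r : ℕ → ℕ) (E : ∀ i, Matrix (Fin (shape r i)) (Fin (shape r (i + 1))) R),
      IsCyclicResolution a E := by
  obtain ⟨k, s, hs⟩ := Submodule.fg_iff_exists_fin_generating_family.mp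
    (IsNoetherian.noetherian a)
  choose next B hB using fun (x : Σ (m n : ℕ), Matrix (Fin m) (Fin n) R) ↦
    exists_exact_act x.2.2
  let x (i : ℕ) : Σ (m n : ℕ), Matrix (Fin m) (Fin n) R :=
    Nat.rec ⟨1, k, .of fun _ j ↦ s j⟩ (fun _ x ↦ ⟨x.2.1, next x, B x⟩) i
  let E : ∀ i, Matrix (Fin (shape (fun i ↦ (x i).2.1) i))
      (Fin (shape (fun i ↦ (x i).2.1) (i + 1))) R
    | 0 => 0
    | 1 => (x 0).2.2
    | i + 2 => B (x i)
  have hE (i : ℕ) (hi : 1 ≤ i) : Function.Exact ((E (i + 1)).act R) ((E i).act R) := by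
    match i, hi with
    | 1, _ => exact hB (x 0)
    | i + 2, _ => exact hB (x (i + 1))
  refine ⟨fun i ↦ (x i).2.1, E, ?_, hE, hs⟩
  intro i
  rcases i with _ | i
  · exact Matrix.zero_mul _
  · apply toLin'.injective
    ext1 j
    ext1
    simp only [LinearMap.comp_apply, toLin'_apply, ← act_eq_mulVec, map_zero,
      LinearMap.zero_apply]
    rw [act_mul]
    exact (hE (i + 1) (by omega)).apply_apply_eq_zero _

namespace IsCyclicResolution

variable {a : Ideal R} {r : ℕ → ℕ}
  {E : ∀ i, Matrix (Fin (shape r i)) (Fin (shape r (i + 1))) R}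

lemma nullAt (h : IsCyclicResolution a E) {x : R} (hx : x ∈ a) (i : ℕ) :
    NullAt (E i) (E (i + 1)) x := by
  induction i with
  | zero =>
    obtain ⟨t, ht⟩ := exists_mul_eq_of_forall_mem_range (E 1)
      (x • (1 : Matrix (Fin (shape r 1)) (Fin (shape r 1)) R)) (by
        intro j
        refine (mem_range_act_iff (E 1) _).mpr ?_
        rw [h.span_eq]
        exact a.mul_mem_right _ hx)
    exact ⟨0, t, by simp [ht]⟩
  | succ i ih => exact ih.succ (h.mul_eq_zero i) (h.exact (i + 1) (by omega))

lemma hasProjectiveDimensionLT_iff (h : IsCyclicResolution a E) (d : ℕ) :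
    HasProjectiveDimensionLT (ModuleCat.of R (R ⧸ a)) (d + 1) ↔
      (E (d + 1)).HasInnerInverse := by
  have e : (E 1).Coker ≃ₗ[R] R ⧸ a :=
    (cokerEquivQuotient (E 1)).trans (Submodule.quotEquivOfEq _ _ h.span_eq)
  rw [← hasProjectiveDimensionLT_coker_iff_exists h.exact]
  exact ⟨fun _ ↦ hasProjectiveDimensionLT_of_iso e.toModuleIso.symm _,
    fun _ ↦ hasProjectiveDimensionLT_of_iso e.toModuleIso _⟩

lemma nullAt_one (h : IsCyclicResolution a E) {d : ℕ}
    (hd : HasProjectiveDimensionLT (ModuleCat.of R (R ⧸ a)) (d + 1)) (i : ℕ) (hi : d < i) :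
    NullAt (E i) (E (i + 1)) 1 :=
  nullAt_one_of_split h.exact h.mul_eq_zero ((h.hasProjectiveDimensionLT_iff d).mp hd) i hi

end IsCyclicResolution

end resolution

end Matrix

open Matrix in
/-- Base change of a perfect cyclic module along a ring homomorphism which preserves the grade
does not increase the projective dimension. -/
theorem Ideal.hasProjectiveDimensionLT_quotient_map {R S : Type u} [CommRing R]
    [IsNoetherianRing R] [CommRing S] (φ : R →+* S) {a : Ideal R} {rs : List R}
    (hrs : ∀ x ∈ rs, x ∈ a) (hreg : RingTheory.Sequence.IsWeaklyRegular S (rs.map φ))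
    (hd : HasProjectiveDimensionLT (ModuleCat.of R (R ⧸ a)) (rs.length + 1)) :
    HasProjectiveDimensionLT (ModuleCat.of S (S ⧸ a.map φ)) (rs.length + 1) := by
  obtain ⟨r, E, h⟩ := exists_isCyclicResolution a
  have hmul (i : ℕ) : (E i).map φ * (E (i + 1)).map φ = 0 := by
    rw [← Matrix.map_mul, h.mul_eq_zero, Matrix.map_zero _ (map_zero φ)]
  have h' : IsCyclicResolution (a.map φ) (fun i ↦ (E i).map φ) := by
    refine ⟨hmul, fun i hi ↦ ?_, ?_⟩
    -- The contractibility bound equals the length of the sequence, so exactness holds in every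
    -- positive degree.
    · refine exact_of_isWeaklyRegular (E := fun i ↦ (E i).map φ) hmul (g := rs.length)
        (fun i hi ↦ ?_) (rs := rs.map φ) ?_ hreg (by simp; omega)
      · simpa using (h.nullAt_one hd i hi).map φ
      · intro y hy i
        obtain ⟨x, hx, rfl⟩ := List.mem_map.mp hy
        exact (h.nullAt (hrs x hx) i).map φ
    · rw [← h.span_eq, Ideal.map_span, ← Set.range_comp]
      rfl
  obtain ⟨T, hT⟩ := (h.hasProjectiveDimensionLT_iff _).mp hd
  refine (h'.hasProjectiveDimensionLT_iff _).mpr ⟨T.map φ, ?_⟩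
  rw [← Matrix.map_mul, ← Matrix.map_mul, hT]

open RingTheory.Sequence in
/-- Frobenius powers of a perfect ideal. -/
theorem Ideal.hasProjectiveDimensionLT_quotient_map_iterateFrobenius {R : Type u} [CommRing R]
    [IsNoetherianRing R] (p : ℕ) [ExpChar R p] (e : ℕ) {a : Ideal R} {rs : List R}
    (hrs : ∀ x ∈ rs, x ∈ a) (hreg : IsWeaklyRegular R rs)
    (hd : HasProjectiveDimensionLT (ModuleCat.of R (R ⧸ a)) (rs.length + 1)) :
    HasProjectiveDimensionLT (ModuleCat.of R (R ⧸ a.map (iterateFrobenius R p e)))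
      (rs.length + 1) :=
  a.hasProjectiveDimensionLT_quotient_map (iterateFrobenius R p e) hrs
    (hreg.map_pow (p ^ e)) hd

end

/-! ### Growth of the homology of Frobenius twists. -/

section

open Module

section length

variable {R : Type u} [CommRing R]

/-- Z/ker β surjects onto X and embeds in Y. This compares lengths through a correspondence when
there is no direct map. -/
lemma Module.length_le_of_ker_le {X Y Z : Type*} [AddCommGroup X] [Module R X]
    [AddCommGroup Y] [Module R Y] [AddCommGroup Z] [Module R Z] (α : Z →ₗ[R] X) (β : Z →ₗ[R] Y)
    (hα : Function.Surjective α) (h : LinearMap.ker β ≤ LinearMap.ker α) :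
    Module.length R X ≤ Module.length R Y := by
  have h₁ : Module.length R X ≤ Module.length R (Z ⧸ LinearMap.ker β) := by
    refine Module.length_le_of_surjective ((LinearMap.ker β).liftQ α h) ?_
    rw [← LinearMap.range_eq_top, Submodule.range_liftQ, LinearMap.range_eq_top]
    exact hα
  refine h₁.trans (Module.length_le_of_injective ((LinearMap.ker β).liftQ β le_rfl) ?_)
  rw [← LinearMap.ker_eq_bot]
  exact Submodule.ker_liftQ_eq_bot _ _ _ le_rfl

lemma Module.length_le_add_of_exact {X Y Z : Type*} [AddCommGroup X] [Module R X]
    [AddCommGroup Y] [Module R Y] [AddCommGroup Z] [Module R Z] (f : X →ₗ[R] Y) (g : Y →ₗ[R] Z)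
    (h : Function.Exact f g) :
    Module.length R Y ≤ Module.length R X + Module.length R Z := by
  rw [Module.length_eq_add_of_exact (LinearMap.ker g).subtype g.rangeRestrict
    (Submodule.subtype_injective _) g.surjective_rangeRestrict (by
      rw [LinearMap.exact_iff, LinearMap.ker_rangeRestrict, Submodule.range_subtype])]
  gcongr
  · rw [h.linearMap_ker_eq]
    exact Module.length_le_of_surjective f.rangeRestrict f.surjective_rangeRestrict
  · exact Module.length_le_of_injective _ (Submodule.subtype_injective _)

end length

namespace Matrix

variable {R : Type u} [CommRing R] {l m n k : ℕ}

/-- The homology at the middle term of the complex `N^n → N^m → N^l` given by matrices. -/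
abbrev Homology (A : Matrix (Fin l) (Fin m) R) (B : Matrix (Fin m) (Fin n) R)
    (N : Type v) [AddCommGroup N] [Module R N] : Type v :=
  LinearMap.ker (A.act N) ⧸ (LinearMap.range (B.act N)).submoduleOf (LinearMap.ker (A.act N))

variable {A : Matrix (Fin l) (Fin m) R} {B : Matrix (Fin m) (Fin n) R}
  {C : Matrix (Fin n) (Fin k) R}

namespace Homology

section

variable {N : Type v} [AddCommGroup N] [Module R N]

/-- The class of a cycle. -/
def mk (z : Fin m → N) (hz : A.act N z = 0) : Homology A B N :=
  Submodule.Quotient.mk ⟨z, hz⟩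

lemma mk_surjective (x : Homology A B N) : ∃ z hz, x = mk z hz := by
  obtain ⟨⟨z, hz⟩, rfl⟩ := Submodule.Quotient.mk_surjective _ x
  exact ⟨z, hz, rfl⟩

lemma mk_eq_zero_iff (z : Fin m → N) (hz : A.act N z = 0) :
    (mk z hz : Homology A B N) = 0 ↔ ∃ w, B.act N w = z := by
  rw [mk, Submodule.Quotient.mk_eq_zero]
  rfl

/-- Functoriality of the homology in the coefficient module. -/
def map {N' : Type w} [AddCommGroup N'] [Module R N'] (f : N →ₗ[R] N') :
    Homology A B N →ₗ[R] Homology A B N' :=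
  Submodule.mapQ _ _
    ((f.compLeft (Fin m)).restrict (p := LinearMap.ker (A.act N)) (q := LinearMap.ker (A.act N'))
      (fun z hz ↦ by
        change A.act N' (f ∘ z) = 0
        rw [act_comp, LinearMap.mem_ker.mp hz]
        ext; simp))
    (by
      rintro ⟨z, hz⟩ ⟨w, hw⟩
      exact ⟨f ∘ w, by rw [act_comp, hw]; rfl⟩)

lemma map_mk {N' : Type w} [AddCommGroup N'] [Module R N'] (f : N →ₗ[R] N') (z : Fin m → N)
    (hz : A.act N z = 0) :
    map f (mk z hz : Homology A B N) = mk (f ∘ z) (by rw [act_comp, hz]; ext; simp) := rfl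

end

section

variable {N₁ N₂ N₃ : Type v} [AddCommGroup N₁] [Module R N₁] [AddCommGroup N₂] [Module R N₂]
  [AddCommGroup N₃] [Module R N₃] {f : N₁ →ₗ[R] N₂} {g : N₂ →ₗ[R] N₃}

lemma map_exact (hAB : A * B = 0) (hf : Function.Injective f) (hg : Function.Surjective g)
    (hfg : Function.Exact f g) :
    Function.Exact (map f : Homology A B N₁ →ₗ[R] _) (map g) := by
  intro x
  obtain ⟨z, hz, rfl⟩ := mk_surjective x
  constructor
  · intro h
    rw [map_mk, mk_eq_zero_iff] at h
    obtain ⟨w, hw⟩ := h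
    choose w' hw' using fun i ↦ hg (w i)
    have hgw : g ∘ w' = w := funext hw'
    have hz' : g ∘ (z - B.act N₂ w') = 0 := by
      have : g ∘ B.act N₂ w' = g ∘ z := by rw [← act_comp, hgw, hw]
      ext i
      simpa [sub_eq_zero] using (congrFun this i).symm
    choose y hy using fun i ↦ (hfg _).mp (congrFun hz' i)
    have hy' : f ∘ y = z - B.act N₂ w' := funext hy
    have hAy : A.act N₁ y = 0 := by
      have : f ∘ A.act N₁ y = 0 := by
        rw [← act_comp, hy', map_sub, hz, ← act_mul, hAB, act_zero, sub_zero]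
      ext i
      exact hf (by simpa using congrFun this i)
    refine ⟨mk y hAy, ?_⟩
    rw [map_mk, ← sub_eq_zero]
    refine (mk_eq_zero_iff (f ∘ y - z) _).mpr ⟨-w', ?_⟩
    rw [hy', map_neg]; abel
  · rintro ⟨x, hx⟩
    obtain ⟨y, hy, rfl⟩ := mk_surjective x
    rw [← hx, map_mk, map_mk, mk_eq_zero_iff]
    refine ⟨0, ?_⟩
    ext i
    simp [hfg.apply_apply_eq_zero]

lemma length_le_add (hAB : A * B = 0) (hf : Function.Injective f) (hg : Function.Surjective g)
    (hfg : Function.Exact f g) :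
    Module.length R (Homology A B N₂) ≤
      Module.length R (Homology A B N₁) + Module.length R (Homology A B N₃) :=
  Module.length_le_add_of_exact _ _ (map_exact hAB hf hg hfg)

end

variable {N : Type v} [AddCommGroup N] [Module R N]

lemma length_le_mul : Module.length R (Homology A B N) ≤ m * Module.length R N := by
  calc Module.length R (Homology A B N)
      ≤ Module.length R (LinearMap.ker (A.act N)) :=
        Module.length_le_of_surjective _ (Submodule.mkQ_surjective _)
    _ ≤ Module.length R (Fin m → N) :=
        Module.length_le_of_injective _ (Submodule.subtype_injective _)
    _ = m * Module.length R N := by simp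

lemma length_eq_zero_of_nullAt (h : NullAt A B 1) : Module.length R (Homology A B N) = 0 := by
  rw [Module.length_eq_zero_iff]
  refine subsingleton_of_forall_eq 0 fun x ↦ ?_
  obtain ⟨z, hz, rfl⟩ := mk_surjective x
  rw [mk_eq_zero_iff]
  simpa using h.smul_mem_range hz

open scoped Pointwise in
/-- If a regular element kills the homology, the length of the homology is bounded by the length
of the homology one degree higher of the quotient. -/
lemma length_le_length_quotSMulTop {y : R} (hy : IsSMulRegular N y) (hAB : A * B = 0)
    (hBC : B * C = 0) (hn : NullAt A B y) :
    Module.length R (Homology A B N) ≤ Module.length R (Homology B C (QuotSMulTop y N)) := by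
  -- The connecting map as a correspondence: in a pair (w, z) with Bw = yz, the class of w modulo y
  -- is sent to the class of z.
  let Z : Submodule R ((Fin n → N) × (Fin m → N)) :=
    LinearMap.ker ((B.act N).comp (LinearMap.fst R _ _) - y • LinearMap.snd R _ _)
  have hZ (z : Z) : B.act N z.1.1 = y • z.1.2 := by
    have := z.2
    rwa [LinearMap.mem_ker, LinearMap.sub_apply, sub_eq_zero] at this
  have hZA (z : Z) : A.act N z.1.2 = 0 := by
    apply smul_fun_injective hy
    rw [← map_smul, ← hZ, ← act_mul, hAB, act_zero, smul_zero]
  have hZB (z : Z) : B.act (QuotSMulTop y N) ((y • (⊤ : Submodule R N)).mkQ ∘ z.1.1) = 0 := by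
    erw [act_comp, hZ, mkQ_comp_smul]
  let α : Z →ₗ[R] Homology A B N :=
    { toFun := fun z ↦ mk z.1.2 (hZA z)
      map_add' := fun _ _ ↦ rfl
      map_smul' := fun _ _ ↦ rfl }
  let β : Z →ₗ[R] Homology B C (QuotSMulTop y N) :=
    { toFun := fun z ↦ mk _ (hZB z)
      map_add' := fun _ _ ↦ rfl
      map_smul' := fun _ _ ↦ rfl }
  refine Module.length_le_of_ker_le α β ?_ ?_
  · intro x
    obtain ⟨z, hz, rfl⟩ := mk_surjective x
    obtain ⟨w, hw⟩ := hn.smul_mem_range hz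
    exact ⟨⟨(w, z), by simp [Z, hw]⟩, rfl⟩
  · intro z hz
    obtain ⟨v, hv⟩ := (mk_eq_zero_iff _ _).mp (LinearMap.mem_ker.mp hz)
    exact (mk_eq_zero_iff _ _).mpr (eq_of_connecting hy hBC (hZ z) hv)

/-- N/xʲN has a filtration with j factors N/xN, and length of homology is subadditive on short exact
sequences. -/
lemma length_quotSMulTop_pow_le {x : R} (hx : IsSMulRegular N x) (hAB : A * B = 0) (j : ℕ) :
    Module.length R (Homology A B (QuotSMulTop (x ^ j) N)) ≤
      j * Module.length R (Homology A B (QuotSMulTop x N)) := by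
  induction j with
  | zero =>
    have : Subsingleton (QuotSMulTop (x ^ 0) N) := by
      rw [pow_zero, Submodule.Quotient.subsingleton_iff]
      simp
    refine length_le_mul.trans ?_
    simp [Module.length_eq_zero]
  | succ j ih =>
    obtain ⟨f, g, hf, hg, hfg⟩ := QuotSMulTop.exists_exact_pow_succ hx j
    refine (length_le_add hAB hf hg hfg).trans ?_
    rw [Nat.cast_succ, add_mul, one_mul]
    gcongr

end Homology

open IsLocalRing in
/-- The growth of the homology of the Frobenius powers of a complex of length `g`. -/
theorem exists_length_homology_le {A : Type u} [CommRing A] [IsNoetherianRing A] [IsLocalRing A]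
    {r : ℕ → ℕ} (E : ∀ (_ : ℕ) i, Matrix (Fin (r i)) (Fin (r (i + 1))) A)
    (hE : ∀ e i, E e i * E e (i + 1) = 0) {g p : ℕ} (hp : 1 ≤ p)
    (hg : ∀ e i, g < i → NullAt (E e i) (E e (i + 1)) 1) {I : Set A}
    (hI : ∀ x ∈ I, ∀ e i, NullAt (E e i) (E e (i + 1)) (x ^ p ^ e))
    (hIm : ∀ q : Ideal A, q.IsPrime → I ⊆ q → q = maximalIdeal A)
    (j i : ℕ) (hij : g ≤ i + j) (N : Type u) [AddCommGroup N] [Module A N] [Module.Finite A N] :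
    ∃ c : ℕ, ∀ e, Module.length A (Homology (E e i) (E e (i + 1)) N) ≤ (c * (p ^ e) ^ j : ℕ) := by
  induction j generalizing i N with
  | zero => ?_
  | succ j ih => ?_
  all_goals
    induction ‹Module.Finite A N› using
      IsNoetherianRing.induction_on_isQuotientEquivQuotientPrime A with
    | subsingleton N =>
      refine ⟨0, fun e ↦ Homology.length_le_mul.trans ?_⟩
      simp [Module.length_eq_zero]
    | exact N₁ N₂ N₃ f f' hf hf' hff' h₁ h₃ =>
      obtain ⟨c₁, h₁⟩ := h₁
      obtain ⟨c₃, h₃⟩ := h₃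
      refine ⟨c₁ + c₃, fun e ↦ (Homology.length_le_add (hE e i) hf hf' hff').trans ?_⟩
      rw [add_mul, Nat.cast_add]
      exact add_le_add (h₁ e) (h₃ e)
    | quotient N q f => ?_
  all_goals
    by_cases hq : q.1 = maximalIdeal A
    -- Over the residue field the rank of the free module bounds the homology for every e at once.
    · refine ⟨r (i + 1), fun e ↦ Homology.length_le_mul.trans ?_⟩
      have : IsSimpleModule A (A ⧸ maximalIdeal A) :=
        isSimpleModule_iff_isCoatom.mpr (maximalIdeal.isMaximal A).out
      rw [f.length_eq, hq, Module.length_eq_one, mul_one, Nat.cast_le]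
      exact Nat.le_mul_of_pos_right _ (by positivity)
    obtain ⟨x, hxI, hxq⟩ : ∃ x ∈ I, x ∉ q.1 := by
      by_contra! h
      exact hq (hIm q.1 q.2 h)
    have hx : IsSMulRegular N x := by
      rw [f.isSMulRegular_congr, isSMulRegular_quotient_iff_mem_of_smul_mem]
      exact fun y hy ↦ (q.2.mem_or_mem hy).resolve_left hxq
    -- Here N ≅ A/q with x regular on it, and x^(p^e) kills the homology of the e-th twist. One
    -- degree up over N/x^(p^e)N, the homology vanishes if j = 0; otherwise filtering by p^e copies
    -- of N/xN supplies the extra factor p^e.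
    have key (e : ℕ) := Homology.length_le_length_quotSMulTop (hx.pow (p ^ e)) (hE e i)
      (hE e (i + 1)) (hI x hxI e i)
  · refine ⟨0, fun e ↦ (key e).trans ?_⟩
    rw [Homology.length_eq_zero_of_nullAt (hg e (i + 1) (by omega))]
    exact zero_le
  · obtain ⟨c, hc⟩ := ih (i + 1) (by omega) (QuotSMulTop x N)
    refine ⟨c, fun e ↦ (key e).trans ((Homology.length_quotSMulTop_pow_le hx (hE e _) _).trans ?_)⟩
    calc ((p ^ e : ℕ) : ℕ∞) * _ ≤ ((p ^ e : ℕ) : ℕ∞) * (c * (p ^ e) ^ j : ℕ) := by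
          gcongr
          exact hc e
      _ = _ := by rw [← Nat.cast_mul]; congr 1; ring

end Matrix

end

/-! ### Length growth, Krull dimension and the new intersection theorem. -/

section

open Module

section dimension

open IsLocalRing

variable {A : Type u} [CommRing A] [IsNoetherianRing A]

/-- A consequence of the Artin–Rees lemma: division by `x` modulo a prime not containing `x`. -/
lemma Ideal.exists_mem_sup_pow_of_mul_mem (I q : Ideal A) [q.IsPrime] {x : A} (hx : x ∉ q) :
    ∃ k, ∀ n b, x * b ∈ q ⊔ I ^ (n + k) → b ∈ q ⊔ I ^ n := by
  have hmem (n : ℕ) (b : A) :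
      b ∈ q ⊔ I ^ n ↔ q.mkQ b ∈ (I ^ n • ⊤ : Submodule A (A ⧸ q)) := by
    have : (I ^ n • ⊤ : Submodule A (A ⧸ q)) =
        Submodule.map q.mkQ (I ^ n) := by
      rw [← Submodule.range_mkQ q, ← Submodule.map_top, ← Submodule.map_smul'']
      simp
    rw [this, ← Submodule.mem_comap, Submodule.comap_map_mkQ]
  let f : (A ⧸ q) →ₗ[A] (A ⧸ q) := LinearMap.lsmul A _ x
  obtain ⟨k, hk⟩ := Ideal.exists_pow_inf_eq_pow_smul I (LinearMap.range f)
  refine ⟨k, fun n b hb ↦ ?_⟩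
  rw [hmem] at hb ⊢
  have h₁ : q.mkQ (x * b) ∈ I ^ n • (I ^ k • ⊤ ⊓ LinearMap.range f) := by
    have := hk (n + k) (by omega)
    rw [Nat.add_sub_cancel] at this
    rw [← this]
    exact ⟨hb, q.mkQ b, by simp [f, ← smul_eq_mul]⟩
  have h₂ : q.mkQ (x * b) ∈ (I ^ n • (⊤ : Submodule A (A ⧸ q))).map f := by
    rw [Submodule.map_smul'', Submodule.map_top]
    exact Submodule.smul_mono le_rfl inf_le_right h₁
  obtain ⟨d, hd, hd'⟩ := h₂
  have hreg : IsSMulRegular (A ⧸ q) x := by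
    rw [isSMulRegular_quotient_iff_mem_of_smul_mem]
    exact fun y hy ↦ (Ideal.IsPrime.mem_or_mem ‹_› hy).resolve_left hx
  have : q.mkQ b = d := hreg (by
    change x • q.mkQ b = x • d
    rw [← map_smul, smul_eq_mul, ← hd']
    rfl)
  rwa [this]

/-- Multiply by some x in q' but not in q on A/(q + I^(n+k)): the cokernel surjects onto A/(q' +
I^(n+k)), and by Artin–Rees the image surjects onto A/(q + I^n). -/
lemma Ideal.exists_length_quotient_add_le (I q q' : Ideal A) [q.IsPrime] (hqq' : q < q') :
    ∃ k, ∀ n, Module.length A (A ⧸ (q' ⊔ I ^ (n + k))) + Module.length A (A ⧸ (q ⊔ I ^ n)) ≤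
      Module.length A (A ⧸ (q ⊔ I ^ (n + k))) := by
  obtain ⟨x, hxq', hxq⟩ := Set.exists_of_ssubset hqq'
  obtain ⟨k, hk⟩ := I.exists_mem_sup_pow_of_mul_mem q hxq
  refine ⟨k, fun n ↦ ?_⟩
  set J := q ⊔ I ^ (n + k)
  set J' := q' ⊔ I ^ (n + k)
  have hJJ' : J ≤ J' := sup_le_sup_right hqq'.le _
  let f : A →ₗ[A] A ⧸ J := J.mkQ ∘ₗ LinearMap.lsmul A A x
  have h₁ : Module.length A (A ⧸ (q ⊔ I ^ n)) ≤ Module.length A (LinearMap.range f) := by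
    refine Module.length_le_of_ker_le (q ⊔ I ^ n).mkQ f.rangeRestrict
      (Submodule.mkQ_surjective _) fun b hb ↦ ?_
    rw [LinearMap.ker_rangeRestrict] at hb
    rw [Submodule.ker_mkQ]
    refine hk n b ?_
    have : J.mkQ (x * b) = 0 := hb
    rwa [Submodule.mkQ_apply, Submodule.Quotient.mk_eq_zero] at this
  have h₂ : Module.length A (A ⧸ J') ≤ Module.length A ((A ⧸ J) ⧸ LinearMap.range f) := by
    refine Module.length_le_of_ker_le J'.mkQ ((LinearMap.range f).mkQ ∘ₗ J.mkQ)
      (Submodule.mkQ_surjective _) fun b hb ↦ ?_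
    have hb' : J.mkQ b ∈ LinearMap.range f := by
      rwa [LinearMap.mem_ker, LinearMap.comp_apply, ← LinearMap.mem_ker,
        Submodule.ker_mkQ] at hb
    obtain ⟨c, hc⟩ := hb'
    have hc' : x * c - b ∈ J := (Submodule.Quotient.eq J).mp hc
    rw [Submodule.ker_mkQ]
    have := J'.sub_mem (show x * c ∈ J' from Ideal.mem_sup_left (q'.mul_mem_right c hxq'))
      (hJJ' hc')
    simpa using this
  rw [Module.length_eq_add_of_exact (LinearMap.range f).subtype (LinearMap.range f).mkQ
    (Submodule.subtype_injective _) (Submodule.mkQ_surjective _)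
    (by rw [LinearMap.exact_iff, Submodule.range_subtype, Submodule.ker_mkQ]), add_comm]
  exact add_le_add h₁ h₂

lemma Module.length_quotient_mono {A : Type u} [CommRing A] {I J : Ideal A} (h : I ≤ J) :
    Module.length A (A ⧸ J) ≤ Module.length A (A ⧸ I) :=
  Module.length_le_of_surjective (Submodule.factor h) (Submodule.factor_surjective h)

/-- Each step gains one copy of A/(q' + I^n) at the cost of k in the exponent. Since T is free,
taking it proportional to n makes the growth for q' one degree smaller than for q. -/
lemma Ideal.exists_mul_length_quotient_le (I q q' : Ideal A) [q.IsPrime] (hqq' : q < q') :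
    ∃ k : ℕ, ∀ n T : ℕ, T * Module.length A (A ⧸ (q' ⊔ I ^ n)) ≤
      Module.length A (A ⧸ (q ⊔ I ^ (n + T * k))) := by
  obtain ⟨k, hk⟩ := I.exists_length_quotient_add_le q q' hqq'
  refine ⟨k, fun n T ↦ ?_⟩
  induction T with
  | zero => simp
  | succ T ih =>
    rw [Nat.cast_succ, add_mul, one_mul, Nat.succ_mul, ← add_assoc, add_comm]
    refine le_trans (add_le_add ?_ ih) (hk (n + T * k))
    exact Module.length_quotient_mono (sup_le_sup_left (Ideal.pow_le_pow_right (by omega)) _)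

variable [IsLocalRing A]

/-- Polynomial growth of the lengths of `A ⧸ (q + 𝔪ⁿ)` bounds the dimension of `A ⧸ q`. -/
theorem PrimeSpectrum.coheight_le_of_length_le (g c : ℕ) (q : PrimeSpectrum A)
    (h : ∀ n : ℕ, Module.length A (A ⧸ (q.1 ⊔ maximalIdeal A ^ n)) ≤ (c * n ^ g : ℕ)) :
    Order.coheight q ≤ g := by
  induction g generalizing q c with
  | zero =>
    rw [Nat.cast_zero, nonpos_iff_eq_zero, Order.coheight_eq_zero, isMax_iff_forall_not_lt]
    intro q' hq'
    have := q.2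
    obtain ⟨k, hk⟩ := (maximalIdeal A).exists_mul_length_quotient_le q.1 q'.1 hq'
    have hnt : Nontrivial (A ⧸ (q'.1 ⊔ maximalIdeal A ^ 1)) := by
      rw [pow_one, sup_eq_right.mpr (le_maximalIdeal q'.2.ne_top)]
      exact Ideal.Quotient.nontrivial_iff.mpr (maximalIdeal.isMaximal A).ne_top
    -- For g = 0 the lengths are bounded by c, but T = c + 1 copies of a nonzero module exceed c.
    have h₁ : (1 : ℕ∞) ≤ Module.length A (A ⧸ (q'.1 ⊔ maximalIdeal A ^ 1)) :=
      Order.one_le_iff_pos.mpr (Module.length_pos_iff.mpr hnt)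
    have h₂ : ((c + 1 : ℕ) : ℕ∞) ≤ (c : ℕ) := calc
      ((c + 1 : ℕ) : ℕ∞) = (c + 1 : ℕ) * 1 := by rw [mul_one]
      _ ≤ _ := by gcongr
      _ ≤ _ := hk 1 (c + 1)
      _ ≤ _ := h _
      _ = c := by simp
    exact absurd (Nat.cast_le.mp h₂) (by omega)
  | succ g ih =>
    rw [Order.coheight_le_coe_iff]
    intro q' hq'
    have := q.2
    obtain ⟨k, hk⟩ := (maximalIdeal A).exists_mul_length_quotient_le q.1 q'.1 hq'
    refine lt_of_le_of_lt (ih (c * (1 + k) ^ (g + 1)) q' fun n ↦ ?_)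
      (Nat.cast_lt.mpr (Nat.lt_succ_self g))
    rcases Nat.eq_zero_or_pos n with rfl | hn
    · have : Subsingleton (A ⧸ (q'.1 ⊔ maximalIdeal A ^ 0)) := by
        rw [pow_zero, Ideal.one_eq_top, sup_top_eq]
        exact Ideal.Quotient.subsingleton_iff.mpr rfl
      rw [Module.length_eq_zero]
      exact zero_le
    -- With T = n the exponent is n(1 + k); cancelling one factor n lowers the degree of the bound.
    have h₁ := (hk n n).trans (h _)
    have hne : Module.length A (A ⧸ (q'.1 ⊔ maximalIdeal A ^ n)) ≠ ⊤ := by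
      intro htop
      rw [htop, ENat.mul_top (by exact_mod_cast hn.ne')] at h₁
      exact ENat.natCast_ne_top _ (top_le_iff.mp h₁)
    obtain ⟨t, ht⟩ := ENat.ne_top_iff_exists.mp hne
    rw [← ht] at h₁ ⊢
    have h₂ : n * t ≤ c * (n + n * k) ^ (g + 1) := by exact_mod_cast h₁
    refine Nat.cast_le.mpr (Nat.le_of_mul_le_mul_left (h₂.trans_eq ?_) hn)
    rw [show n + n * k = n * (1 + k) by ring, mul_pow]
    ring

/-- Every n > 0 lies below a power of p that is at most pn, so a bound along powers of p yields one
for all n with constant c·p^g. -/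
theorem ringKrullDim_le_of_length_le {g c p : ℕ} (hp : 1 < p)
    (h : ∀ e : ℕ, Module.length A (A ⧸ maximalIdeal A ^ p ^ e) ≤ (c * (p ^ e) ^ g : ℕ)) :
    ringKrullDim A ≤ g := by
  rw [ringKrullDim, Order.krullDim_eq_iSup_coheight, iSup_le_iff]
  intro q
  refine WithBot.coe_le_coe.mpr (q.coheight_le_of_length_le g (c * p ^ g) fun n ↦ ?_)
  rcases Nat.eq_zero_or_pos n with rfl | hn
  · have : Subsingleton (A ⧸ (q.1 ⊔ maximalIdeal A ^ 0)) := by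
      rw [pow_zero, Ideal.one_eq_top, sup_top_eq]
      exact Ideal.Quotient.subsingleton_iff.mpr rfl
    rw [Module.length_eq_zero]
    exact zero_le
  have h₁ : n ≤ p ^ (Nat.log p n + 1) := (Nat.lt_pow_succ_log_self hp n).le
  have h₂ : p ^ (Nat.log p n + 1) ≤ p * n := by
    rw [pow_succ']
    exact Nat.mul_le_mul_left _ (Nat.pow_log_le_self p hn.ne')
  calc Module.length A (A ⧸ (q.1 ⊔ maximalIdeal A ^ n))
      ≤ Module.length A (A ⧸ maximalIdeal A ^ p ^ (Nat.log p n + 1)) :=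
        Module.length_quotient_mono ((Ideal.pow_le_pow_right h₁).trans le_sup_right)
    _ ≤ _ := h _
    _ ≤ _ := by
      rw [mul_assoc, ← mul_pow]
      gcongr

end dimension

open Matrix IsLocalRing in
/-- The new intersection theorem for cyclic modules in prime characteristic. -/
theorem Ideal.height_le_of_mem_minimalPrimes_of_hasProjectiveDimensionLT {R : Type u} [CommRing R]
    [IsNoetherianRing R] (p : ℕ) [Fact p.Prime] [CharP R p] {a P : Ideal R}
    (hP : P ∈ a.minimalPrimes) {g : ℕ}
    (hg : CategoryTheory.HasProjectiveDimensionLT (ModuleCat.of R (R ⧸ a)) (g + 1)) :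
    P.height ≤ g := by
  have hPp : P.IsPrime := hP.1.1
  obtain ⟨r, E, h⟩ := exists_isCyclicResolution a
  let A := Localization.AtPrime P
  let φ (e : ℕ) : R →+* A := (algebraMap R A).comp (iterateFrobenius R p e)
  have hφ (e : ℕ) (x : R) : φ e x = algebraMap R A x ^ p ^ e := by
    simp [φ, iterateFrobenius_def]
  obtain ⟨c, hc⟩ := exists_length_homology_le (A := A) (r := shape r)
    (fun e i ↦ (E i).map (φ e))
    (fun e i ↦ by rw [← Matrix.map_mul, h.mul_eq_zero, Matrix.map_zero _ (map_zero _)])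
    (g := g) (p := p) (Fact.out : p.Prime).one_le
    (fun e i hi ↦ by simpa using (h.nullAt_one hg i hi).map (φ e))
    (I := algebraMap R A '' a) (by
      rintro _ ⟨x, hx, rfl⟩ e i
      rw [← hφ]
      exact (h.nullAt hx i).map (φ e)) (by
      -- Minimality of P over `a` leaves only the maximal ideal of A above the image of `a`.
      intro q hq hle
      refine Localization.AtPrime.eq_maximalIdeal_iff_under_eq.mp ?_
      have hqP : q.under R ≤ P :=
        (Ideal.comap_mono (le_maximalIdeal hq.ne_top)).trans
          Localization.AtPrime.under_maximalIdeal.le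
      exact le_antisymm hqP (hP.2 ⟨hq.under R, fun x hx ↦ hle ⟨x, hx, rfl⟩⟩ hqP)) g 0 (by omega) A
  have hdim : ringKrullDim A ≤ g := by
    refine ringKrullDim_le_of_length_le (c := c) (Fact.out : p.Prime).one_lt fun e ↦ ?_
    refine le_trans ?_ (hc e)
    -- In degree 0 every vector is a cycle, and boundaries lie in m^(p^e) because the entries of `E
    -- 1` belong to `a` ⊆ P.
    refine Module.length_le_of_ker_le
      ((maximalIdeal A ^ p ^ e).mkQ ∘ₗ (LinearMap.proj (0 : Fin 1)) ∘ₗ Submodule.subtype _)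
      (Submodule.mkQ _) ?_ ?_
    · intro y
      obtain ⟨y, rfl⟩ := Submodule.mkQ_surjective _ y
      exact ⟨⟨fun _ ↦ y, funext fun i ↦ Fin.elim0 i⟩, rfl⟩
    · rintro ⟨z, hz⟩ hz'
      rw [Submodule.ker_mkQ] at hz'
      obtain ⟨w, hw⟩ := hz'
      change Submodule.Quotient.mk (z (0 : Fin 1)) = 0
      rw [Submodule.Quotient.mk_eq_zero]
      have : z (0 : Fin 1) = ∑ j, φ e (E 1 (0 : Fin 1) j) • w j := (congrFun hw (0 : Fin 1)).symm
      rw [this]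
      refine Submodule.sum_mem _ fun j _ ↦ Ideal.mul_mem_right _ _ ?_
      rw [hφ]
      refine Ideal.pow_mem_pow ?_ _
      refine (IsLocalization.AtPrime.to_map_mem_maximal_iff A P _).mpr (hP.1.2 ?_)
      rw [← h.span_eq]
      exact Ideal.subset_span ⟨j, rfl⟩
  rw [IsLocalization.AtPrime.ringKrullDim_eq_height P A] at hdim
  exact WithBot.coe_le_coe.mp hdim

open RingTheory.Sequence in
-- After localising at P the sequence is regular, and a regular sequence lowers the dimension by its
-- length.
lemma Ideal.length_le_height_of_isWeaklyRegular {R : Type u} [CommRing R] [IsNoetherianRing R]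
    {P : Ideal R} [P.IsPrime] {rs : List R} (h : IsWeaklyRegular R rs) (hP : ∀ x ∈ rs, x ∈ P) :
    (rs.length : ℕ∞) ≤ P.height := by
  let A := Localization.AtPrime P
  have h' : IsRegular A (rs.map (algebraMap R A)) := h.isRegular_of_isLocalization_of_mem A P hP
  have hdim := ringKrullDim_add_length_eq_ringKrullDim_of_isRegular _ h'
  have hnt : Nontrivial (A ⧸ ofList (rs.map (algebraMap R A))) := by
    apply Ideal.Quotient.nontrivial_iff.mpr
    intro htop
    exact h'.2 (by simp [htop])
  rw [IsLocalization.AtPrime.ringKrullDim_eq_height P A, List.length_map] at hdim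
  have : (rs.length : WithBot ℕ∞) ≤ P.height := by
    rw [← hdim]
    exact le_add_of_nonneg_left ringKrullDim_nonneg_of_nontrivial
  exact WithBot.coe_le_coe.mp this

end

/-! ### Comparing the derived-functor `Ext` with `Abelian.Ext`. -/

section

open CategoryTheory Limits Opposite

lemma CategoryTheory.epi_of_comp_iso_hom_eq {C : Type v} [Category.{w} C] {X Y X' Y' : C}
    {f : X ⟶ Y} {g : X' ⟶ Y'} {e : X ≅ X'} {e' : Y ≅ Y'} (h : f ≫ e'.hom = e.hom ≫ g) [Epi g] :
    Epi f := by
  rw [← Iso.eq_comp_inv] at h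
  rw [h]
  infer_instance

namespace ModuleCat

variable {R : Type u} [CommRing R]

lemma mono_homologyMap_succ {K L : CochainComplex (ModuleCat.{u} R) ℕ} (φ : K ⟶ L) (m : ℕ)
    (h : ∀ z : K.X (m + 1), (K.d (m + 1) (m + 2)) z = 0 →
      (∃ w : L.X m, L.d m (m + 1) w = φ.f (m + 1) z) → ∃ w : K.X m, K.d m (m + 1) w = z) :
    Mono (HomologicalComplex.homologyMap φ (m + 1)) := by
  rw [ModuleCat.mono_iff_injective, injective_iff_map_eq_zero]
  intro x hx
  obtain ⟨z, rfl⟩ := (ModuleCat.epi_iff_surjective (K.homologyπ (m + 1))).mp inferInstance x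
  have hL : (ShortComplex.mk (L.toCycles m (m + 1)) (L.homologyπ (m + 1)) (by simp)).Exact :=
    ShortComplex.exact_of_g_is_cokernel _ (L.homologyIsCokernel m (m + 1) (by simp))
  rw [← ConcreteCategory.comp_apply, HomologicalComplex.homologyπ_naturality,
    ConcreteCategory.comp_apply] at hx
  obtain ⟨w, hw⟩ := (ShortComplex.moduleCat_exact_iff _).mp hL _ hx
  obtain ⟨w', hw'⟩ := h (K.iCycles (m + 1) z) (by
    rw [← ConcreteCategory.comp_apply, HomologicalComplex.iCycles_d]; rfl) ⟨w, by
      have := congrArg (L.iCycles (m + 1)) hw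
      dsimp at this
      rw [← ConcreteCategory.comp_apply, HomologicalComplex.toCycles_i,
        ← ConcreteCategory.comp_apply, HomologicalComplex.cyclesMap_i,
        ConcreteCategory.comp_apply] at this
      exact this⟩
  have hz : K.toCycles m (m + 1) w' = z := by
    apply (ModuleCat.mono_iff_injective (K.iCycles (m + 1))).mp inferInstance
    rw [← ConcreteCategory.comp_apply, HomologicalComplex.toCycles_i, hw']
  rw [← hz, ← ConcreteCategory.comp_apply, HomologicalComplex.toCycles_comp_homologyπ]
  rfl

lemma epi_homologyMap_op_of_mono {ι : Type*} {c : ComplexShape ι}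
    {K L : HomologicalComplex (ModuleCat.{u} R) c} (θ : K ⟶ L) (n : ι)
    (h : Mono (HomologicalComplex.homologyMap θ n)) :
    Epi (HomologicalComplex.homologyMap
      ((HomologicalComplex.opFunctor (ModuleCat.{u} R) c).map θ.op) n) := by
  have := op_epi_of_mono (HomologicalComplex.homologyMap θ n)
  exact epi_of_comp_iso_hom_eq (HomologicalComplex.homologyOp_hom_naturality θ n)

variable {X X' : ModuleCat.{u} R} (M : ModuleCat.{u} R)

/-- Both theories are computed by Hom out of projective resolutions. Local cohomology is built from
`Ext`, while the long exact sequences are used for `Abelian.Ext`; this carries injectivity across.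
-/
lemma mono_Ext_map_succ (f : X' ⟶ X) (m : ℕ)
    (h : ∀ α : Abelian.Ext X M (m + 1),
      (Abelian.Ext.mk₀ f).comp α (zero_add _) = 0 → α = 0) :
    Mono (((Ext R (ModuleCat.{u} R) (m + 1)).map f.op).app M) := by
  let P := ProjectiveResolution.of X
  let P' := ProjectiveResolution.of X'
  let φ := ProjectiveResolution.lift f P' P
  have hφ : φ ≫ P.π = P'.π ≫ (ChainComplex.single₀ _).map f := by simp [φ]
  let Φ : ProjectiveResolution.Hom P' P f := ⟨φ, by
    rw [← HomologicalComplex.comp_f, hφ, HomologicalComplex.comp_f]⟩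
  let F := ((linearYoneda R (ModuleCat.{u} R)).obj M).rightOp
  suffices Epi ((F.leftDerived (m + 1)).map f) from
    inferInstanceAs (Mono ((F.leftDerived (m + 1)).map f).unop)
  rw [F.leftDerived_map_eq (m + 1) f φ hφ]
  have : Epi (HomologicalComplex.homologyMap ((F.mapHomologicalComplex _).map φ) (m + 1)) := by
    refine epi_homologyMap_op_of_mono ((HomologicalComplex.unopFunctor (ModuleCat.{u} R) _).map
      ((F.mapHomologicalComplex _).map φ).op) _ (mono_homologyMap_succ _ _ ?_)
    rintro (z : P.complex.X (m + 1) ⟶ M) (hz : P.complex.d (m + 2) (m + 1) ≫ z = 0)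
      ⟨(w : P'.complex.X m ⟶ M), hw⟩
    replace hw : P'.complex.d (m + 1) m ≫ w = φ.f (m + 1) ≫ z := hw
    have h₁ := ProjectiveResolution.mk₀_comp_extMk z (m + 2) rfl hz Φ
    have h₂ := h _ (h₁.trans ((P'.extMk_eq_zero_iff _ _ _ _ m rfl).mpr ⟨w, hw⟩))
    exact (P.extMk_eq_zero_iff _ _ _ _ m rfl).mp h₂
  exact epi_comp' inferInstance (epi_comp' this inferInstance)

lemma isZero_Ext_succ_iff (m : ℕ) :
    IsZero (((Ext R (ModuleCat.{u} R) (m + 1)).obj (op X)).obj M) ↔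
      Subsingleton (Abelian.Ext X M (m + 1)) := by
  let P := ProjectiveResolution.of X
  rw [(P.isoExt (R := R) (m + 1) M).isZero_iff,
    ← HomologicalComplex.exactAt_iff_isZero_homology,
    HomologicalComplex.exactAt_iff' _ m (m + 1) (m + 2) (by simp) (by simp),
    ShortComplex.moduleCat_exact_iff]
  constructor
  · intro h
    refine subsingleton_of_forall_eq 0 fun α ↦ ?_
    obtain ⟨z, hz, rfl⟩ := P.extMk_surjective α (m + 2) rfl
    obtain ⟨w, hw⟩ := h z hz
    exact (P.extMk_eq_zero_iff _ _ _ _ m rfl).mpr ⟨w, hw⟩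
  · rintro h (z : P.complex.X (m + 1) ⟶ M) (hz : P.complex.d (m + 2) (m + 1) ≫ z = 0)
    exact (P.extMk_eq_zero_iff z (m + 2) rfl hz m rfl).mp (Subsingleton.elim _ _)

end ModuleCat

end

/-! ### Depth sensitivity, and local cohomology as a colimit of Ext modules. -/

section

open CategoryTheory Limits Opposite

section regular

open RingTheory.Sequence

variable {R : Type u} [CommRing R]

lemma RingTheory.Sequence.IsWeaklyRegular.of_flat_module {rs : List R} (h : IsWeaklyRegular R rs)
    (M : Type v) [AddCommGroup M] [Module R M] [Module.Flat R M] : IsWeaklyRegular M rs :=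
  ((TensorProduct.rid R M).isWeaklyRegular_congr rs).mp h.isWeaklyRegular_lTensor

namespace ModuleCat

/-- Rees's argument: x annihilates N, hence Ext(N, M), so a class in degree i + 1 comes from degree
i with coefficients M/xM. In degree 0, regularity of x on M leaves only the zero map. -/
lemma subsingleton_ext_of_isWeaklyRegular (N : ModuleCat.{u} R) {rs : List R}
    (hN : ∀ x ∈ rs, ∀ n : N, x • n = 0) (M : ModuleCat.{u} R) (hM : IsWeaklyRegular M rs) {i : ℕ}
    (hi : i < rs.length) : Subsingleton (Abelian.Ext N M i) := by
  induction rs generalizing M i with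
  | nil => simp at hi
  | cons x rs ih =>
    rw [isWeaklyRegular_cons_iff] at hM
    have hx : ∀ n : N, x • n = 0 := hN x (by simp)
    rcases i with _ | i
    · refine Abelian.Ext.homEquiv₀.subsingleton_congr.mpr (subsingleton_of_forall_eq 0 fun f ↦ ?_)
      ext n
      refine hM.1.right_eq_zero_of_smul ?_
      rw [← map_smul, hx, map_zero]
    · refine subsingleton_of_forall_eq 0 fun α ↦ ?_
      have hS : (M.smulShortComplex x).ShortExact := hM.1.smulShortComplex_shortExact
      have hα : α.comp (Abelian.Ext.mk₀ (M.smulShortComplex x).f) (add_zero _) = 0 := by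
        have h0 : x • 𝟙 N = 0 := by
          ext n
          exact hx n
        have : x • α = 0 := by
          have : x • α = (Abelian.Ext.mk₀ (x • 𝟙 N)).comp α (zero_add _) := by
            simp [Abelian.Ext.mk₀_smul]
          rw [this, h0]
          simp
        change α.comp (Abelian.Ext.mk₀ (x • 𝟙 M)) (add_zero _) = 0
        rw [Abelian.Ext.mk₀_smul]
        simpa using this
      obtain ⟨β, rfl⟩ := Abelian.Ext.covariant_sequence_exact₁ N hS α hα (n₀ := i) rfl
      have := ih (fun y hy ↦ hN y (by simp [hy])) (ModuleCat.of R (QuotSMulTop x M)) hM.2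
        (i := i) (by simpa using hi)
      have hβ : β = 0 := Subsingleton.elim (α := Abelian.Ext N
        (ModuleCat.of R (QuotSMulTop x M)) i) _ _
      rw [hβ, Abelian.Ext.zero_comp]
      rfl

/-- Depth sensitivity: along a surjection of modules killed by a regular sequence of length
`m + 1`, the functor `Ext` in degree `m + 1` is injective. -/
lemma eq_zero_of_mk₀_comp_eq_zero {N N' : ModuleCat.{u} R} (f : N' ⟶ N)
    (hf : Function.Surjective f) {rs : List R} (hN : ∀ x ∈ rs, ∀ n : N', x • n = 0)
    {M : ModuleCat.{u} R} (hM : IsWeaklyRegular M rs) {m : ℕ} (hm : m < rs.length)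
    (α : Abelian.Ext N M (m + 1)) (hα : (Abelian.Ext.mk₀ f).comp α (zero_add _) = 0) : α = 0 := by
  have hS : f.hom.shortComplexKer.ShortExact := LinearMap.shortExact_shortComplexKer hf
  obtain ⟨β, hβ⟩ := Abelian.Ext.contravariant_sequence_exact₃ hS M α hα (n₀ := m) (add_comm _ _)
  have := subsingleton_ext_of_isWeaklyRegular (ModuleCat.of R (LinearMap.ker f.hom))
    (fun x hx n ↦ Subtype.ext (hN x hx n.1)) M hM hm
  have hβ0 : β = 0 := Subsingleton.elim (α := Abelian.Ext
    (ModuleCat.of R (LinearMap.ker f.hom)) M m) _ _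
  rw [← hβ, hβ0, Abelian.Ext.comp_zero]

/-- A module of projective dimension `n` has a nonzero `Ext` into a free module in degree `n`. -/
lemma exists_free_not_subsingleton_ext {N : ModuleCat.{u} R} {n : ℕ}
    [HasProjectiveDimensionLT N (n + 1)] (h : ¬ HasProjectiveDimensionLT N n) :
    ∃ M : ModuleCat.{u} R, Module.Free R M ∧ ¬ Subsingleton (Abelian.Ext N M n) := by
  rw [hasProjectiveDimensionLT_iff] at h
  push Not at h
  obtain ⟨i, hi, Y, α, hα⟩ := h
  obtain rfl : i = n := by
    by_contra hne
    exact hα (α.eq_zero_of_hasProjectiveDimensionLT (n + 1) (by omega))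
  refine ⟨Y.projectiveShortComplex.X₂, inferInstance, fun hsub ↦ hα ?_⟩
  -- In the top degree Ext is right exact, so α lifts along a surjection from a free module onto Y.
  obtain ⟨β, rfl⟩ := Abelian.Ext.covariant_sequence_exact₃ N
    Y.shortExact_projectiveShortComplex α rfl
    (Abelian.Ext.eq_zero_of_hasProjectiveDimensionLT _ (i + 1) le_rfl)
  rw [Subsingleton.elim β 0, Abelian.Ext.zero_comp]

end ModuleCat

end regular

namespace localCohomology

variable {R : Type u} [CommRing R]

/-- The directed system of modules `Ext^i(R ⧸ aⁿ, M)` whose colimit is local cohomology. -/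
noncomputable abbrev extSystem (a : Ideal R) (i : ℕ) (M : ModuleCat.{u} R) :
    (ℕᵒᵖ)ᵒᵖ ⥤ ModuleCat.{u} R :=
  diagram (idealPowersDiagram a) i ⋙ (evaluation _ _).obj M

/-- Local cohomology is the colimit of the system `Ext^i(R ⧸ aⁿ, M)`. -/
noncomputable def objIsoColimit (a : Ideal R) (i : ℕ) (M : ModuleCat.{u} R) :
    (localCohomology a i).obj M ≅ colimit (extSystem a i M) :=
  colimitObjIsoColimitCompEvaluation (diagram (idealPowersDiagram a) i) M

/-- A transition map of the system factors through the vanishing Ext of R/b, so every term dies in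
the colimit. Thus any cofinal family of ideals can test vanishing. -/
lemma isZero_of_forall_exists (a : Ideal R) (i : ℕ) (M : ModuleCat.{u} R)
    (h : ∀ n : ℕ, ∃ (b : Ideal R) (k : ℕ), a ^ k ≤ b ∧ b ≤ a ^ n ∧
      IsZero (((Ext R (ModuleCat.{u} R) i).obj (op (ModuleCat.of R (R ⧸ b)))).obj M)) :
    IsZero ((localCohomology a i).obj M) := by
  refine IsZero.of_iso ?_ (objIsoColimit a i M)
  rw [IsZero.iff_id_eq_zero]
  refine colimit.hom_ext fun j ↦ ?_
  obtain ⟨b, k, hkb, hbn, hb⟩ := h j.unop.unop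
  let t : j ⟶ op (op (max k j.unop.unop)) := (homOfLE (le_max_right _ _)).op.op
  have hk : a ^ max k j.unop.unop ≤ b := (Ideal.pow_le_pow_right (le_max_left _ _)).trans hkb
  let f₁ : ModuleCat.of R (R ⧸ a ^ max k j.unop.unop) ⟶ ModuleCat.of R (R ⧸ b) :=
    ModuleCat.ofHom (Submodule.mapQ _ _ LinearMap.id hk)
  let f₂ : ModuleCat.of R (R ⧸ b) ⟶ ModuleCat.of R (R ⧸ a ^ j.unop.unop) :=
    ModuleCat.ofHom (Submodule.mapQ _ _ LinearMap.id hbn)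
  have hf : (ringModIdeals (idealPowersDiagram a)).map t.unop = f₁ ≫ f₂ := by
    ext x
    obtain ⟨x, rfl⟩ := Submodule.Quotient.mk_surjective _ x
    rfl
  have ht : (extSystem a i M).map t = 0 := by
    have h₁₂ : ((Ext R (ModuleCat.{u} R) i).map (f₁ ≫ f₂).op).app M = 0 := by
      rw [op_comp, Functor.map_comp, NatTrans.comp_app,
        hb.eq_zero_of_tgt (((Ext R (ModuleCat.{u} R) i).map f₂.op).app M), zero_comp]
    exact (congrArg (fun f : ModuleCat.of R (R ⧸ a ^ max k j.unop.unop) ⟶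
      ModuleCat.of R (R ⧸ a ^ j.unop.unop) ↦
        ((Ext R (ModuleCat.{u} R) i).map f.op).app M) hf).trans h₁₂
  rw [← colimit.w (extSystem a i M) t, ht]
  simp

/-- An element that is zero in a filtered colimit is already killed by some transition map. -/
lemma not_isZero_of_forall_mono (a : Ideal R) (i : ℕ) (M : ModuleCat.{u} R) (n : ℕ)
    (hn : ¬ IsZero (((Ext R (ModuleCat.{u} R) i).obj (op (ModuleCat.of R (R ⧸ a ^ n)))).obj M))
    (h : ∀ (k : ℕ) (hk : n ≤ k), Mono (((Ext R (ModuleCat.{u} R) i).map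
      (ModuleCat.ofHom (Submodule.mapQ (a ^ k) (a ^ n) LinearMap.id
        (Ideal.pow_le_pow_right hk))).op).app M)) :
    ¬ IsZero ((localCohomology a i).obj M) := by
  intro hzero
  replace hzero : IsZero (colimit (extSystem a i M)) :=
    IsZero.of_iso hzero (objIsoColimit a i M).symm
  apply hn
  have : PreservesFilteredColimitsOfSize.{0, 0} (forget (ModuleCat.{u} R)) :=
    preservesFilteredColimitsOfSize_shrink.{0, u, 0, u} _
  have hsub : Subsingleton ((extSystem a i M).obj (op (op n))) := by
    refine subsingleton_of_forall_eq 0 fun x ↦ ?_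
    obtain ⟨j, t, ht⟩ := Concrete.colimit_rep_eq_zero R (extSystem a i M) (op (op n)) x (by
      rw [hzero.eq_zero_of_tgt (colimit.ι (extSystem a i M) (op (op n)))]
      rfl)
    have hmono := h j.unop.unop (leOfHom t.unop.unop)
    exact (ModuleCat.mono_iff_injective _).mp hmono (ht.trans (map_zero _).symm)
  exact @ModuleCat.isZero_of_subsingleton _ _ _ hsub

end localCohomology

end

/-! ### Vanishing, nonvanishing, height and grade. -/

section

open CategoryTheory Limits Opposite

open RingTheory.Sequence

variable {R : Type u} [CommRing R] {a : Ideal R} {rs : List R}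

/-- In prime characteristic local cohomology vanishes above the grade of a perfect ideal. -/
theorem localCohomology.isZero_of_length_lt [IsNoetherianRing R] (p : ℕ) [Fact p.Prime] [CharP R p]
    (hrs : ∀ x ∈ rs, x ∈ a) (hreg : IsWeaklyRegular R rs)
    (hd : HasProjectiveDimensionLT (ModuleCat.of R (R ⧸ a)) (rs.length + 1))
    (M : ModuleCat.{u} R) {i : ℕ} (hi : rs.length < i) :
    IsZero ((localCohomology a i).obj M) := by
  refine isZero_of_forall_exists a i M fun n ↦ ?_
  have hp : p.Prime := Fact.out
  -- The exponent e = n is large enough for the Frobenius power to lie in aⁿ.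
  have hn : n ≤ p ^ n := (Nat.lt_pow_self hp.one_lt).le
  obtain ⟨k, hk⟩ := Ideal.exists_pow_le_of_le_radical_of_fg
    (I := a) (J := a.map (iterateFrobenius R p n))
    (fun x hx ↦ ⟨p ^ n, Ideal.mem_map_of_mem (iterateFrobenius R p n) hx⟩)
    (IsNoetherian.noetherian a)
  refine ⟨a.map (iterateFrobenius R p n), k, hk, Ideal.map_le_iff_le_comap.mpr fun x hx ↦
    Ideal.pow_le_pow_right hn (Ideal.pow_mem_pow hx _), ?_⟩
  have := a.hasProjectiveDimensionLT_quotient_map_iterateFrobenius p n hrs hreg hd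
  obtain ⟨m, rfl⟩ : ∃ m, i = m + 1 := ⟨i - 1, by omega⟩
  rw [ModuleCat.isZero_Ext_succ_iff]
  exact HasProjectiveDimensionLT.subsingleton _ (rs.length + 1) _ hi _

/-- If the ideal `a` contains a weakly regular sequence of length `g > 0` and `R ⧸ a` has
projective dimension `g`, some local cohomology module of degree `g` is nonzero. -/
theorem localCohomology.exists_not_isZero (hrs : ∀ x ∈ rs, x ∈ a) (hreg : IsWeaklyRegular R rs)
    (hd : HasProjectiveDimensionLT (ModuleCat.of R (R ⧸ a)) (rs.length + 1))
    (hd' : ¬ HasProjectiveDimensionLT (ModuleCat.of R (R ⧸ a)) rs.length)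
    (hpos : rs.length ≠ 0) :
    ∃ M : ModuleCat.{u} R, ¬ IsZero ((localCohomology a rs.length).obj M) := by
  obtain ⟨M, hfree, hM⟩ := ModuleCat.exists_free_not_subsingleton_ext hd'
  obtain ⟨m, hm⟩ := Nat.exists_eq_succ_of_ne_zero hpos
  rw [hm] at hM ⊢
  refine ⟨M, not_isZero_of_forall_mono a (m + 1) M 1 ?_ fun k hk ↦ ?_⟩
  · rwa [ModuleCat.isZero_Ext_succ_iff, pow_one]
  · refine ModuleCat.mono_Ext_map_succ M _ m fun α hα ↦ ?_
    refine ModuleCat.eq_zero_of_mk₀_comp_eq_zero _ ?_ (rs := rs.map (· ^ k)) ?_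
      ((hreg.of_flat_module M).map_pow k) (by simp; omega) α hα
    · intro y
      obtain ⟨y, rfl⟩ := Submodule.Quotient.mk_surjective _ y
      exact ⟨Submodule.Quotient.mk y, rfl⟩
    · intro y hy n
      obtain ⟨x, hx, rfl⟩ := List.mem_map.mp hy
      obtain ⟨n, rfl⟩ := Submodule.Quotient.mk_surjective _ n
      exact (Submodule.Quotient.mk_eq_zero _).mpr
        (Ideal.mul_mem_right _ _ (Ideal.pow_mem_pow (hrs x hx) k))

/-- The intersection theorem at a single minimal prime bounds the height above; the regular sequence
bounds the height of every minimal prime below. -/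
theorem Ideal.height_eq_of_isWeaklyRegular [IsNoetherianRing R] (p : ℕ) [Fact p.Prime]
    [CharP R p] (ha : a ≠ ⊤) (hrs : ∀ x ∈ rs, x ∈ a) (hreg : IsWeaklyRegular R rs)
    (hd : HasProjectiveDimensionLT (ModuleCat.of R (R ⧸ a)) (rs.length + 1)) :
    a.height = rs.length := by
  obtain ⟨P, hP⟩ := Ideal.nonempty_minimalPrimes ha
  apply le_antisymm
  · have := hP.1.1
    exact (Ideal.height_mono hP.1.2).trans
      (Ideal.height_le_of_mem_minimalPrimes_of_hasProjectiveDimensionLT p hP hd)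
  · rw [a.height_eq_inf_minimalPrimes]
    refine le_iInf₂ fun Q hQ ↦ ?_
    have := hQ.isPrime
    exact Ideal.length_le_height_of_isWeaklyRegular hreg fun x hx ↦ hQ.1.2 (hrs x hx)

/-- The grade of a proper ideal of a Noetherian ring is attained by a regular sequence. -/
lemma Ideal.exists_isRegular_length_eq_grade [IsNoetherianRing R] (ha : a ≠ ⊤) :
    ∃ rs : List R, IsRegular R rs ∧ (∀ x ∈ rs, x ∈ a) ∧ a.grade = rs.length := by
  have hnt : Nontrivial R := by
    by_contra h
    rw [not_nontrivial_iff_subsingleton] at h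
    exact ha (Subsingleton.elim _ _)
  obtain ⟨P, hP⟩ := Ideal.nonempty_minimalPrimes ha
  have hPp := hP.1.1
  -- A minimal prime of finite height bounds the supremum, so it is a natural number g; if g > 0
  -- were not attained, g - 1 would be an upper bound.
  have hle : a.grade ≤ P.height := iSup₂_le fun rs h ↦
    Ideal.length_le_height_of_isWeaklyRegular h.1.1 fun x hx ↦ hP.1.2 (h.2 x hx)
  obtain ⟨g, hg⟩ := ENat.ne_top_iff_exists.mp
    (ne_top_of_le_ne_top (Ideal.height_ne_top hPp.ne_top) hle)
  rcases Nat.eq_zero_or_pos g with rfl | hpos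
  · exact ⟨[], .nil R R, by simp, by simpa using hg.symm⟩
  by_contra! hcon
  have : a.grade ≤ (g - 1 : ℕ) := iSup₂_le fun rs h ↦ by
    have h₁ : (rs.length : ℕ∞) ≤ g := by
      rw [hg]
      exact le_iSup₂ (f := fun (rs : List R) _ ↦ (rs.length : ℕ∞)) rs h
    have h₂ : g ≠ rs.length := fun h' ↦ hcon rs h.1 h.2 (by rw [← hg, h'])
    have h₃ : rs.length ≤ g := by exact_mod_cast h₁
    exact Nat.cast_le.mpr (by omega)
  rw [← hg, Nat.cast_le] at this
  omega

end

open CategoryTheory Limits in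
theorem corollary2p2 {R : Type u} [CommRing R] [IsNoetherianRing R]
    (p : ℕ) [Fact p.Prime] [CharP R p] (a : Ideal R) (ha : a.IsPerfect) :
    a.cohomologicalDimension = a.height := by
  have hne : a ≠ ⊤ := by
    rintro rfl
    have h0 : IsZero (ModuleCat.of R (R ⧸ (⊤ : Ideal R))) := by
      have : Subsingleton (R ⧸ (⊤ : Ideal R)) := Ideal.Quotient.subsingleton_iff.mpr rfl
      exact ModuleCat.isZero_of_subsingleton _
    rw [Ideal.IsPerfect, (projectiveDimension_eq_bot_iff _).mpr h0] at ha
    exact WithBot.bot_ne_coe ha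
  obtain ⟨rs, hreg, hrs, hg⟩ := Ideal.exists_isRegular_length_eq_grade hne
  have hpd : projectiveDimension (ModuleCat.of R (R ⧸ a)) = (rs.length : ℕ) := by
    rw [ha, hg]
    rfl
  have hd : HasProjectiveDimensionLT (ModuleCat.of R (R ⧸ a)) (rs.length + 1) :=
    (projectiveDimension_le_iff _ _).mp hpd.le
  have hd' : ¬ HasProjectiveDimensionLT (ModuleCat.of R (R ⧸ a)) rs.length := by
    rw [← projectiveDimension_lt_iff, hpd]
    exact lt_irrefl _
  rw [Ideal.height_eq_of_isWeaklyRegular p hne hrs hreg.1 hd]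
  refine le_antisymm ?_ (le_iInf₂ fun c hc ↦ ?_)
  · exact iInf₂_le (f := fun (c : ℕ) _ ↦ (c : ℕ∞)) rs.length fun M i hi ↦
      localCohomology.isZero_of_length_lt p hrs hreg.1 hd M hi
  · by_contra! hlt
    have hlt' : c < rs.length := by exact_mod_cast hlt
    -- Here c < g forces g > 0; for g = 0 the lower bound is trivial.
    obtain ⟨M, hM⟩ := localCohomology.exists_not_isZero hrs hreg.1 hd hd' (by omega)
    exact hM (hc M _ hlt')
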